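/- Let $d \ge 1$ be an integer, let $\tau > 0$, $s \in \mathbb{R}$ and $h \ge \tau$, and let $C \in L^\infty([s,s+h]\times[-\tau,0],\mathbb{R}^{d\times d})$. Put $X = L^2([-\tau,0],\mathbb{R}^d)$ and, for a function $x$ on $[s-\tau,s+h]$ and $t\in[s,s+h]$, write $x_t(\theta) = x(t+\theta)$ for $\theta\in[-\tau,0]$. For $\phi\in X$ consider the initial value problem for the linear renewal equation $$x(t) = \int_{-\tau}^0 C(t,\theta)\,x_t(\theta)\,d\theta \quad\text{for a.e. } t\in(s,s+h], \qquad x_s = \phi \ \text{ a.e. on } [-\tau,0].$$ Then for every $\phi\in X$ this problem has a solution $x(\cdot\,;s,\phi) \in L^2([s-\tau,s+h],\mathbb{R}^d)$, unique up to equality almost everywhere, and the evolution operator $$T(s+h,s)\colon X\to X,\qquad T(s+h,s)\phi = x_{s+h}(\cdot\,;s,\phi),$$ is a bounded linear operator and is compact. -/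

import Mathlib

open MeasureTheory Set
open scoped ENNReal Matrix

/- All norms on the space of `d × d` matrices are equivalent, so membership in `L^∞` does not depend
on the choice; we use the maximum of the absolute values of the entries. -/
attribute [local instance] Matrix.normedAddCommGroup

namespace RenewalEq

/-- The state space `X = L²([-τ, 0], ℝ^d)`, with the Euclidean norm on `ℝ^d`. -/
abbrev StateSpace (d : ℕ) (τ : ℝ) : Type :=
  Lp (EuclideanSpace ℝ (Fin d)) 2 (volume.restrict (Icc (-τ) 0))

/-- `C ∈ L^∞([s, t] × [-τ, 0], ℝ^{d × d})`. Values of `C` outside the rectangle play no role. -/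
def IsLInfKernel {d : ℕ} (τ s t : ℝ) (C : ℝ → ℝ → Matrix (Fin d) (Fin d) ℝ) : Prop :=
  MemLp (fun p : ℝ × ℝ => C p.1 p.2) ∞ (volume.restrict (Icc s t ×ˢ Icc (-τ) 0))

/-- The history segment `x_t(θ) = x(t + θ)`. -/
def history {E : Type*} (x : ℝ → E) (t θ : ℝ) : E := x (t + θ)

/-- The right-hand side `∫_{-τ}^0 C(t, θ) x_t(θ) dθ` of the renewal equation. -/
noncomputable def rhs {d : ℕ} (τ : ℝ) (C : ℝ → ℝ → Matrix (Fin d) (Fin d) ℝ)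
    (x : ℝ → EuclideanSpace ℝ (Fin d)) (t : ℝ) : EuclideanSpace ℝ (Fin d) :=
  ∫ θ in Icc (-τ) 0, WithLp.toLp 2 (C t θ *ᵥ (history x t θ).ofLp)

/-- `x` is an `L²` solution up to time `t` of the initial value problem
`x(r) = ∫_{-τ}^0 C(r, θ) x_r(θ) dθ` for `s < r ≤ t`, with `x_s = φ`. As usual for `L²` functions, both
equations are required almost everywhere. -/
structure IsSolution {d : ℕ} (τ s t : ℝ) (C : ℝ → ℝ → Matrix (Fin d) (Fin d) ℝ)
    (φ : StateSpace d τ) (x : ℝ → EuclideanSpace ℝ (Fin d)) : Prop where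
  memLp : MemLp x 2 (volume.restrict (Icc (s - τ) t))
  initial : ∀ᵐ θ ∂volume.restrict (Icc (-τ) 0), history x s θ = φ θ
  equation : ∀ᵐ r ∂volume.restrict (Ioc s t), x r = rhs τ C x r

/-- `ψ` is the element `x_t(· ; s, φ)` of the state space, for a solution `x` of the initial value
problem. -/
def IsEvolved {d : ℕ} (τ s t : ℝ) (C : ℝ → ℝ → Matrix (Fin d) (Fin d) ℝ)
    (φ ψ : StateSpace d τ) : Prop :=
  ∃ x : ℝ → EuclideanSpace ℝ (Fin d), IsSolution τ s t C φ x ∧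
    ∀ᵐ θ ∂volume.restrict (Icc (-τ) 0), ψ θ = history x t θ

open Classical in
/-- The evolution operator `T(t, s) : X → X`, `T(t, s) φ = x_t(· ; s, φ)` (and `0` if there were no
solution). -/
noncomputable def evolutionOperator {d : ℕ} (τ : ℝ) (C : ℝ → ℝ → Matrix (Fin d) (Fin d) ℝ)
    (t s : ℝ) (φ : StateSpace d τ) : StateSpace d τ :=
  if h : ∃ ψ, IsEvolved τ s t C φ ψ then h.choose else 0

end RenewalEq

/-! On `K = [s - τ, s + h]` the substitution `u = t + θ` turns the problem into `x = E φ + V x` in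
`L²(K)`. Here `E` places `φ` on `[s - τ, s]` and extends it by zero, and `V` is the integral
operator with bounded Volterra kernel `C(t, u - t)`, cut off to `t > s`. A bounded kernel on a
finite measure space gives a compact operator (`isCompactOperator_of_kernel`), and a Volterra
operator fixes only zero (`volterra_eq_zero`). By the Fredholm alternative `1 - V` has a bounded
inverse `S`, so the unique solution is `S (E φ)`. Since `h ≥ τ`, the final window lies in `[s, s +
h]`, where the solution equals its image under `V`. With `R` the restriction to that window, `T = R
V S E`, which is compact because `V` is. -/

namespace RenewalEq

/-! ### Bounded operator-valued integrands and weak compactness -/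

section BoundedKernels

variable {α F G : Type*} [MeasurableSpace α] [NormedAddCommGroup F]
  [NormedAddCommGroup G]

theorem exists_bounded_representative {μ : Measure α} {f : α → G} (hf : MemLp f ∞ μ) :
    ∃ g : α → G, StronglyMeasurable g ∧ f =ᵐ[μ] g ∧ ∃ M : ℝ, 0 < M ∧ ∀ x, ‖g x‖ ≤ M := by
  obtain ⟨g, hg, hfg⟩ := hf.1
  have hlt : eLpNorm f ∞ μ < ∞ := hf.2
  set M := (eLpNorm f ∞ μ).toReal with hM
  have hb : ∀ᵐ x ∂μ, ‖f x‖ ≤ M := by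
    filter_upwards [ae_le_eLpNormEssSup (f := f) (μ := μ)] with x hx
    rw [← eLpNorm_exponent_top] at hx
    have := ENNReal.toReal_mono hlt.ne hx
    simpa [hM] using this
  -- Cutting `g` to zero where it exceeds the essential bound changes it only on a null set and
  -- makes the bound hold everywhere; `M + 1` is there for strict positivity.
  refine ⟨indicator {x | ‖g x‖ ≤ M} g, hg.indicator (hg.norm.measurable measurableSet_Iic), ?_,
    M + 1, by positivity, fun x => ?_⟩
  · filter_upwards [hb, hfg] with x h1 h2
    rw [indicator_of_mem, h2]
    rwa [mem_ofPred_eq, ← h2]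
  · by_cases hx : ‖g x‖ ≤ M
    · rw [indicator_of_mem (by exact hx)]; linarith
    · rw [indicator_of_notMem (by exact hx), norm_zero]
      positivity

variable {μ : Measure α}

/-- Cauchy–Schwarz against the constant function 1. -/
theorem integral_norm_le_mul_norm [IsFiniteMeasure μ] (x : Lp F 2 μ) :
    ∫ u, ‖x u‖ ∂μ ≤ (μ univ ^ (1 / 2 : ℝ)).toReal * ‖x‖ := by
  have h := eLpNorm_le_eLpNorm_mul_rpow_measure_univ (p := 1) (q := 2) (by norm_num)
    (Lp.aestronglyMeasurable x)
  rw [integral_norm_eq_lintegral_enorm (Lp.aestronglyMeasurable x), Lp.norm_def, ← ENNReal.toReal_mul,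
    ← eLpNorm_one_eq_lintegral_enorm]
  refine ENNReal.toReal_mono (ENNReal.mul_ne_top ?_ (Lp.eLpNorm_ne_top x)) ?_
  · exact ENNReal.rpow_ne_top_of_nonneg (by norm_num) (measure_ne_top _ _)
  · rw [mul_comm]
    convert h using 2
    norm_num

variable [NormedSpace ℝ F]

theorem integrable_clm_apply {L : α → F →L[ℝ] F} (hL : StronglyMeasurable L) {M : ℝ}
    (hM : ∀ u, ‖L u‖ ≤ M) {x : α → F} (hx : Integrable x μ) :
    Integrable (fun u => L u (x u)) μ := by
  refine (hx.norm.const_mul M).mono' ?_ (Filter.Eventually.of_forall fun u => ?_)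
  · exact (ContinuousLinearMap.apply ℝ F).flip.aestronglyMeasurable_comp₂
      hL.aestronglyMeasurable hx.1
  · exact (L u).le_of_opNorm_le (hM u) _

theorem norm_integral_clm_apply_le {L : α → F →L[ℝ] F} {M : ℝ}
    (hM : ∀ u, ‖L u‖ ≤ M) {x : α → F} (hx : Integrable x μ) :
    ‖∫ u, L u (x u) ∂μ‖ ≤ M * ∫ u, ‖x u‖ ∂μ := by
  rw [← integral_const_mul]
  exact norm_integral_le_of_norm_le (hx.norm.const_mul M)
    (Filter.Eventually.of_forall fun u => (L u).le_of_opNorm_le (hM u) _)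

/-- Integration against a bounded operator-valued function, as a continuous linear map on `L²`. -/
theorem exists_clm_integral_clm_apply [IsFiniteMeasure μ] {L : α → F →L[ℝ] F}
    (hL : StronglyMeasurable L) {M : ℝ} (hM : ∀ u, ‖L u‖ ≤ M) :
    ∃ Λ : Lp F 2 μ →L[ℝ] F, ∀ x : Lp F 2 μ, Λ x = ∫ u, L u (x u) ∂μ := by
  have hi : ∀ x : Lp F 2 μ, Integrable x μ := fun x => (Lp.memLp x).integrable (by norm_num)
  refine ⟨LinearMap.mkContinuous
    { toFun := fun x => ∫ u, L u (x u) ∂μ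
      map_add' := fun x y => ?_
      map_smul' := fun c x => ?_ } (max M 0 * (μ univ ^ (1 / 2 : ℝ)).toReal) (fun x => ?_),
    fun x => rfl⟩
  · rw [← integral_add (integrable_clm_apply hL hM (hi x)) (integrable_clm_apply hL hM (hi y))]
    refine integral_congr_ae ?_
    filter_upwards [Lp.coeFn_add x y] with u hu
    rw [hu, Pi.add_apply, map_add]
  · rw [RingHom.id_apply, ← integral_smul]
    refine integral_congr_ae ?_
    filter_upwards [Lp.coeFn_smul c x] with u hu
    rw [hu, Pi.smul_apply, map_smul]
  · rw [mul_assoc]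
    refine (norm_integral_clm_apply_le (fun u => (hM u).trans (le_max_left M 0)) (hi x)).trans ?_
    exact mul_le_mul_of_nonneg_left (integral_norm_le_mul_norm x) (le_max_right M 0)

/-- Weak sequential compactness of balls in a separable Hilbert space. -/
theorem exists_subseq_weakly_tendsto {H : Type*} [NormedAddCommGroup H] [InnerProductSpace ℝ H]
    [CompleteSpace H] [SecondCountableTopology H] {r : ℝ} {x : ℕ → H} (hx : ∀ n, ‖x n‖ ≤ r) :
    ∃ (y : H) (φ : ℕ → ℕ), StrictMono φ ∧ ‖y‖ ≤ r ∧
      ∀ f : StrongDual ℝ H, Filter.Tendsto (fun n => f (x (φ n))) Filter.atTop (nhds (f y)) := by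
  -- Sequential Banach–Alaoglu in the dual, carried back to `H` by the Riesz isometry.
  obtain ⟨y, hy, φ, hφ, hlim⟩ := WeakDual.isSeqCompact_closedBall ℝ H 0 r
    (x := fun n => StrongDual.toWeakDual (InnerProductSpace.toDual ℝ H (x n)))
    (fun n => by simpa using hx n)
  refine ⟨(InnerProductSpace.toDual ℝ H).symm (WeakDual.toStrongDual y), φ, hφ, ?_, fun f => ?_⟩
  · simpa using hy
  · have h := (WeakBilin.tendsto_iff_forall_eval_tendsto _
      (ContinuousLinearMap.coe_injective)).1 hlim ((InnerProductSpace.toDual ℝ H).symm f)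
    have e : ∀ z : H, f z = inner ℝ z ((InnerProductSpace.toDual ℝ H).symm f) := fun z => by
      rw [real_inner_comm, InnerProductSpace.toDual_symm_apply]
    simp_rw [e]
    rw [InnerProductSpace.toDual_symm_apply]
    exact h

end BoundedKernels

/-! ### Integral operators on `L²`: boundedness, compactness, Volterra uniqueness -/

section KernelOperator

variable {α β F : Type*} [MeasurableSpace α] [MeasurableSpace β] [NormedAddCommGroup F]

section

variable [NormedSpace ℝ F]

/-- Composition with a map `g`, followed by extension by zero outside `A`, is bounded on `L²`. -/
theorem exists_clm_indicator_comp {μ : Measure α} {ν : Measure β} {g : α → β} (hg : Measurable g)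
    {A : Set α} (hA : MeasurableSet A) (h : (μ.restrict A).map g ≤ ν) :
    ∃ R : Lp F 2 ν →L[ℝ] Lp F 2 μ, ∀ x : Lp F 2 ν, R x =ᵐ[μ] A.indicator (x ∘ g) := by
  have hq : ∀ {p : β → Prop}, (∀ᵐ b ∂ν, p b) → ∀ᵐ a ∂μ, a ∈ A → p (g a) := fun hp =>
    (ae_restrict_iff' hA).1 (ae_of_ae_map hg.aemeasurable (ae_mono h hp))
  have hsm : ∀ x : Lp F 2 ν, AEStronglyMeasurable x ((μ.restrict A).map g) := fun x =>
    (Lp.stronglyMeasurable x).aestronglyMeasurable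
  have hn : ∀ x : Lp F 2 ν, eLpNorm (A.indicator (x ∘ g)) 2 μ ≤ eLpNorm x 2 ν := fun x => by
    rw [eLpNorm_indicator_eq_eLpNorm_restrict hA, ← eLpNorm_map_measure (hsm x) hg.aemeasurable]
    exact eLpNorm_mono_measure _ h
  have hm : ∀ x : Lp F 2 ν, MemLp (A.indicator (x ∘ g)) 2 μ := fun x =>
    ⟨((Lp.stronglyMeasurable x).comp_measurable hg).indicator hA |>.aestronglyMeasurable,
      (hn x).trans_lt (Lp.eLpNorm_lt_top x)⟩
  refine ⟨LinearMap.mkContinuous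
    { toFun := fun x => (hm x).toLp _
      map_add' := fun x y => ?_
      map_smul' := fun c x => ?_ } 1 (fun x => ?_), fun x => (hm x).coeFn_toLp⟩
  · rw [← MemLp.toLp_add]
    refine MemLp.toLp_congr _ _ ?_
    filter_upwards [hq (Lp.coeFn_add x y)] with a ha
    by_cases haA : a ∈ A
    · simpa [haA] using ha haA
    · simp [haA]
  · rw [RingHom.id_apply, ← MemLp.toLp_const_smul]
    refine MemLp.toLp_congr _ _ ?_
    filter_upwards [hq (Lp.coeFn_smul c x)] with a ha
    by_cases haA : a ∈ A
    · simpa [haA] using ha haA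
    · simp [haA]
  · rw [one_mul]
    change ‖(hm x).toLp _‖ ≤ ‖x‖
    rw [Lp.norm_toLp, Lp.norm_def]
    exact ENNReal.toReal_mono (Lp.eLpNorm_ne_top x) (hn x)

/-- A bounded kernel on a finite measure space defines a bounded integral operator on `L²`. -/
theorem exists_clm_kernel {μ : Measure α} [IsFiniteMeasure μ] {k : α × α → F →L[ℝ] F}
    (hk : StronglyMeasurable k) {M : ℝ} (hM0 : 0 ≤ M) (hM : ∀ p, ‖k p‖ ≤ M) :
    ∃ V : Lp F 2 μ →L[ℝ] Lp F 2 μ,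
      ∀ x : Lp F 2 μ, V x =ᵐ[μ] fun t => ∫ u, k (t, u) (x u) ∂μ := by
  have hi : ∀ x : Lp F 2 μ, Integrable x μ := fun x => (Lp.memLp x).integrable (by norm_num)
  have hkt : ∀ t, StronglyMeasurable fun u => k (t, u) := fun t =>
    hk.comp_measurable measurable_prodMk_left
  have hb : ∀ (x : Lp F 2 μ) (t : α),
      ‖∫ u, k (t, u) (x u) ∂μ‖ ≤ M * ((μ univ ^ (1 / 2 : ℝ)).toReal * ‖x‖) := fun x t =>
    (norm_integral_clm_apply_le (fun u => hM (t, u)) (hi x)).trans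
      (mul_le_mul_of_nonneg_left (integral_norm_le_mul_norm x) hM0)
  have hm : ∀ x : Lp F 2 μ, MemLp (fun t => ∫ u, k (t, u) (x u) ∂μ) 2 μ := fun x => by
    refine MemLp.of_bound ?_ _ (Filter.Eventually.of_forall (hb x))
    have : StronglyMeasurable fun p : α × α => k p (x p.2) :=
      isBoundedBilinearMap_apply.continuous.comp_stronglyMeasurable
        (hk.prodMk ((Lp.stronglyMeasurable x).comp_measurable measurable_snd))
    exact this.integral_prod_right'.aestronglyMeasurable
  refine ⟨LinearMap.mkContinuous
    { toFun := fun x => (hm x).toLp _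
      map_add' := fun x y => ?_
      map_smul' := fun c x => ?_ }
    (measureUnivNNReal μ ^ (2 : ℝ≥0∞).toReal⁻¹ * (M * (μ univ ^ (1 / 2 : ℝ)).toReal))
    (fun x => ?_), fun x => (hm x).coeFn_toLp⟩
  · rw [← MemLp.toLp_add]
    refine MemLp.toLp_congr _ _ (Filter.Eventually.of_forall fun t => ?_)
    obtain ⟨Λ, hΛ⟩ := exists_clm_integral_clm_apply (μ := μ) (hkt t) (fun u => hM (t, u))
    simp only [Pi.add_apply, ← hΛ, map_add]
  · rw [RingHom.id_apply, ← MemLp.toLp_const_smul]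
    refine MemLp.toLp_congr _ _ (Filter.Eventually.of_forall fun t => ?_)
    obtain ⟨Λ, hΛ⟩ := exists_clm_integral_clm_apply (μ := μ) (hkt t) (fun u => hM (t, u))
    simp only [Pi.smul_apply, ← hΛ, map_smul]
  · change ‖(hm x).toLp _‖ ≤ _
    rw [mul_assoc, mul_assoc]
    refine Lp.norm_le_of_ae_bound (by positivity) ?_
    filter_upwards [(hm x).coeFn_toLp] with t ht
    rw [ht]
    exact hb x t

end

/-- On a finite measure space, an integral operator on `L²` with a bounded kernel is compact. -/
theorem isCompactOperator_of_kernel [InnerProductSpace ℝ F] [FiniteDimensional ℝ F]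
    [MeasurableSpace.CountablyGenerated α]
    {μ : Measure α} [IsFiniteMeasure μ] {k : α × α → F →L[ℝ] F}
    (hk : StronglyMeasurable k) {M : ℝ} (hM0 : 0 ≤ M) (hM : ∀ p, ‖k p‖ ≤ M)
    {V : Lp F 2 μ →L[ℝ] Lp F 2 μ}
    (hV : ∀ x : Lp F 2 μ, V x =ᵐ[μ] fun t => ∫ u, k (t, u) (x u) ∂μ) :
    IsCompactOperator V := by
  have : CompleteSpace F := FiniteDimensional.complete ℝ F
  have : ProperSpace F := FiniteDimensional.proper ℝ F
  have : Fact ((2 : ℝ≥0∞) ≠ ∞) := ⟨by norm_num⟩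
  have hi : ∀ x : Lp F 2 μ, Integrable x μ := fun x => (Lp.memLp x).integrable (by norm_num)
  have hkt : ∀ t, StronglyMeasurable fun u => k (t, u) := fun t =>
    hk.comp_measurable measurable_prodMk_left
  -- The image of the closed unit ball is itself compact: weak limits stay in the ball, so no
  -- closure is needed.
  refine (isCompactOperator_iff_exists_mem_nhds_image_subset_compact V).2
    ⟨Metric.closedBall 0 1, Metric.closedBall_mem_nhds _ one_pos, V '' Metric.closedBall 0 1,
      IsSeqCompact.isCompact fun z hz => ?_, subset_rfl⟩
  choose x hx hxz using hz
  obtain ⟨y, φ, hφ, hy, hlim⟩ := exists_subseq_weakly_tendsto (r := 1) (x := x)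
    (fun n => by simpa using hx n)
  refine ⟨V y, ⟨y, by simpa using hy, rfl⟩, φ, hφ, ?_⟩
  -- For fixed `t` the integral is a bounded `F`-valued map; as `F` is finite-dimensional, weak
  -- convergence can be tested on its coordinates.
  have hpt : ∀ t, Filter.Tendsto (fun n => ∫ u, k (t, u) (x (φ n) u) ∂μ) Filter.atTop
      (nhds (∫ u, k (t, u) (y u) ∂μ)) := fun t => by
    obtain ⟨Λ, hΛ⟩ := exists_clm_integral_clm_apply (μ := μ) (hkt t) (fun u => hM (t, u))
    simp_rw [← hΛ]
    let e := (Module.finBasis ℝ F).equivFunL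
    let e' : F →L[ℝ] (Fin (Module.finrank ℝ F) → ℝ) := e
    have : Filter.Tendsto (fun n => e (Λ (x (φ n)))) Filter.atTop (nhds (e (Λ y))) :=
      tendsto_pi_nhds.2 fun i =>
        hlim ((ContinuousLinearMap.proj (R := ℝ) (φ := fun _ => ℝ) i).comp (e'.comp Λ))
    simpa [Function.comp_def] using (e.symm.continuous.tendsto _).comp this
  have hb : ∀ (w : Lp F 2 μ), ‖w‖ ≤ 1 → ∀ t : α,
      ‖∫ u, k (t, u) (w u) ∂μ‖ ≤ M * (μ univ ^ (1 / 2 : ℝ)).toReal := fun w hw t =>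
    (norm_integral_clm_apply_le (fun u => hM (t, u)) (hi w)).trans
      (mul_le_mul_of_nonneg_left ((integral_norm_le_mul_norm w).trans
        (mul_le_of_le_one_right ENNReal.toReal_nonneg hw)) hM0)
  set B := M * (μ univ ^ (1 / 2 : ℝ)).toReal
  rw [Lp.tendsto_Lp_iff_tendsto_eLpNorm']
  -- Dominated convergence: the integrals are bounded by `B` uniformly on the unit ball, and
  -- constants are integrable.
  have hpow : Filter.Tendsto (fun n => ∫⁻ t, ‖(∫ u, k (t, u) (x (φ n) u) ∂μ) -
      ∫ u, k (t, u) (y u) ∂μ‖ₑ ^ (2 : ℝ) ∂μ) Filter.atTop (nhds (∫⁻ _, 0 ∂μ)) := by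
    have hmeas : ∀ w : Lp F 2 μ, StronglyMeasurable fun t => ∫ u, k (t, u) (w u) ∂μ := fun w => by
      have : StronglyMeasurable fun p : α × α => k p (w p.2) :=
        isBoundedBilinearMap_apply.continuous.comp_stronglyMeasurable
          (hk.prodMk ((Lp.stronglyMeasurable w).comp_measurable measurable_snd))
      exact this.integral_prod_right'
    refine tendsto_lintegral_of_dominated_convergence (fun _ => ENNReal.ofReal (B + B) ^ (2 : ℝ))
      (fun n => (((hmeas _).sub (hmeas _)).enorm.pow_const _)) (fun n => ?_) ?_ ?_
    · refine Filter.Eventually.of_forall fun t => ENNReal.rpow_le_rpow ?_ (by norm_num)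
      rw [← ofReal_norm]
      refine ENNReal.ofReal_le_ofReal ((norm_sub_le _ _).trans (add_le_add (hb _ ?_ t) (hb _ hy t)))
      simpa using hx (φ n)
    · rw [lintegral_const]
      exact ENNReal.mul_ne_top (ENNReal.rpow_ne_top_of_nonneg (by norm_num) ENNReal.ofReal_ne_top)
        (measure_ne_top _ _)
    · refine Filter.Eventually.of_forall fun t => ?_
      have h0 := ((hpt t).sub_const (∫ u, k (t, u) (y u) ∂μ)).enorm
      rw [sub_self, enorm_zero] at h0
      simpa [Function.comp_def] using (ENNReal.continuous_rpow_const (y := 2)).tendsto _ |>.comp h0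
  rw [lintegral_zero] at hpow
  have hroot := (ENNReal.continuous_rpow_const (y := 1 / 2)).tendsto _ |>.comp hpow
  rw [ENNReal.zero_rpow_of_pos (by norm_num)] at hroot
  refine hroot.congr fun n => ?_
  rw [eLpNorm_eq_lintegral_rpow_enorm_toReal (by norm_num) (by norm_num)]
  simp only [Function.comp_apply, ENNReal.toReal_ofNat]
  congr 1
  refine lintegral_congr_ae ?_
  filter_upwards [hV (x (φ n)), hV y] with t h1 h2
  rw [Pi.sub_apply, ← hxz, h1, h2]

/-- A Volterra operator has no nonzero fixed points. -/
theorem volterra_eq_zero [NormedSpace ℝ F] {a b : ℝ} {k : ℝ × ℝ → F →L[ℝ] F}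
    {M : ℝ} (hM0 : 0 < M) (hM : ∀ p, ‖k p‖ ≤ M) (hvol : ∀ t u, t < u → k (t, u) = 0)
    {x : ℝ → F} (hx : IntegrableOn x (Icc a b))
    (heq : ∀ᵐ t ∂volume.restrict (Icc a b), x t = ∫ u in Icc a b, k (t, u) (x u)) :
    x =ᵐ[volume.restrict (Icc a b)] 0 := by
  have hbound : ∀ t ∈ Icc a b, ‖∫ u in Icc a b, k (t, u) (x u)‖ ≤ M * ∫ u in Icc a t, ‖x u‖ := by
    intro t ht
    rw [show ∫ u in Icc a b, k (t, u) (x u) = ∫ u in Icc a t, k (t, u) (x u) from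
      setIntegral_eq_of_subset_of_forall_sdiff_eq_zero measurableSet_Icc
        (Icc_subset_Icc_right ht.2) fun u hu => ?_]
    · exact norm_integral_clm_apply_le (fun u => hM (t, u))
        (hx.mono_set (Icc_subset_Icc_right ht.2))
    · rw [hvol t u (not_le.1 fun h => hu.2 ⟨hu.1.1, h⟩), _root_.zero_apply]
  set A := M * ∫ u in Icc a b, ‖x u‖
  have hA0 : 0 ≤ A := mul_nonneg hM0.le (integral_nonneg fun _ => norm_nonneg _)
  -- Exponentially weighted Picard iteration: integrating the weight `exp (2M(t - a))` gains `1 /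
  -- (2M)`, so each use of the equation, which costs `M`, halves the bound.
  have key : ∀ n : ℕ, ∀ᵐ t ∂volume.restrict (Icc a b),
      ‖x t‖ ≤ A * (1 / 2) ^ n * Real.exp (2 * M * (t - a)) := by
    intro n
    induction n with
    | zero =>
      filter_upwards [heq, ae_restrict_mem measurableSet_Icc] with t h1 ht
      rw [h1, pow_zero, mul_one]
      refine (hbound t ht).trans ?_
      have h2 : ∫ u in Icc a t, ‖x u‖ ≤ ∫ u in Icc a b, ‖x u‖ :=
        setIntegral_mono_set hx.norm (Filter.Eventually.of_forall fun _ => norm_nonneg _)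
          (Icc_subset_Icc_right ht.2).eventuallyLE
      have h3 : 1 ≤ Real.exp (2 * M * (t - a)) :=
        Real.one_le_exp (mul_nonneg (by positivity) (sub_nonneg.2 ht.1))
      exact (mul_le_mul_of_nonneg_left h2 hM0.le).trans (le_mul_of_one_le_right hA0 h3)
    | succ n ih =>
      filter_upwards [heq, ae_restrict_mem measurableSet_Icc] with t h1 ht
      rw [h1]
      refine (hbound t ht).trans ?_
      have hcont : Continuous fun u => A * (1 / 2) ^ n * Real.exp (2 * M * (u - a)) := by fun_prop
      have h2 : ∫ u in Icc a t, ‖x u‖ ≤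
          ∫ u in Icc a t, A * (1 / 2) ^ n * Real.exp (2 * M * (u - a)) := by
        refine integral_mono_ae (hx.mono_set (Icc_subset_Icc_right ht.2)).norm
          hcont.integrableOn_Icc ?_
        exact ae_restrict_of_ae_restrict_of_subset (Icc_subset_Icc_right ht.2) ih
      have h3 : ∫ u in Icc a t, A * (1 / 2) ^ n * Real.exp (2 * M * (u - a)) =
          A * (1 / 2) ^ n * ((Real.exp (2 * M * (t - a)) - 1) / (2 * M)) := by
        rw [integral_Icc_eq_integral_Ioc, ← intervalIntegral.integral_of_le ht.1,
          intervalIntegral.integral_eq_sub_of_hasDerivAt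
            (f := fun u => A * (1 / 2) ^ n * (Real.exp (2 * M * (u - a)) / (2 * M)))
            (fun u _ => ?_) (hcont.intervalIntegrable _ _)]
        · simp
          ring
        · have h4 : HasDerivAt (fun u => 2 * M * (u - a)) (2 * M * 1) u :=
            ((hasDerivAt_id u).sub_const a).const_mul _
          refine ((h4.exp.div_const (2 * M)).const_mul (A * (1 / 2) ^ n)).congr_deriv ?_
          rw [mul_one, mul_div_cancel_right₀ _ (by positivity)]
      calc M * ∫ u in Icc a t, ‖x u‖
          ≤ M * (A * (1 / 2) ^ n * ((Real.exp (2 * M * (t - a)) - 1) / (2 * M))) :=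
            mul_le_mul_of_nonneg_left (h2.trans h3.le) hM0.le
        _ = A * (1 / 2) ^ (n + 1) * (Real.exp (2 * M * (t - a)) - 1) := by
            field_simp
            ring
        _ ≤ _ := mul_le_mul_of_nonneg_left (by linarith) (by positivity)
  filter_upwards [ae_all_iff.2 key] with t ht
  have hlim : Filter.Tendsto (fun n : ℕ => A * (1 / 2 : ℝ) ^ n * Real.exp (2 * M * (t - a)))
      Filter.atTop (nhds (A * 0 * Real.exp (2 * M * (t - a)))) :=
    ((tendsto_pow_atTop_nhds_zero_of_lt_one (by norm_num) (by norm_num)).const_mul A).mul_const _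
  have := ge_of_tendsto' hlim ht
  rw [mul_zero, zero_mul] at this
  exact norm_le_zero_iff.1 this

end KernelOperator

/-! ### Translation of time windows and the fixed point formulation -/

theorem map_add_left_restrict_le {A B : Set ℝ} (hB : MeasurableSet B) {c : ℝ}
    (h : ∀ t ∈ A, c + t ∈ B) :
    (volume.restrict A).map (fun t => c + t) ≤ volume.restrict B := by
  refine (Measure.map_mono (Measure.restrict_mono (show A ⊆ (fun t => c + t) ⁻¹' B from h) le_rfl)
    (measurable_const_add c)).trans ?_
  exact ((measurePreserving_add_left volume c).restrict_preimage hB).map_eq.le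

theorem ae_restrict_add_left {A B : Set ℝ} (hB : MeasurableSet B) {c : ℝ}
    (h : ∀ t ∈ A, c + t ∈ B) {p : ℝ → Prop} (hp : ∀ᵐ t ∂volume.restrict B, p t) :
    ∀ᵐ t ∂volume.restrict A, p (c + t) :=
  ae_of_ae_map (measurable_const_add c).aemeasurable (ae_mono (map_add_left_restrict_le hB h) hp)

variable {d : ℕ} {τ s h : ℝ} {C : ℝ → ℝ → Matrix (Fin d) (Fin d) ℝ}

/-- The right-hand side of the renewal equation is an integral operator of Volterra type with a
bounded kernel. -/
theorem exists_volterra_kernel (hC : IsLInfKernel τ s (s + h) C) :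
    ∃ k : ℝ × ℝ → EuclideanSpace ℝ (Fin d) →L[ℝ] EuclideanSpace ℝ (Fin d),
      StronglyMeasurable k ∧ (∃ M : ℝ, 0 < M ∧ ∀ p, ‖k p‖ ≤ M) ∧
      (∀ t u, t < u → k (t, u) = 0) ∧ (∀ t ≤ s, ∀ u, k (t, u) = 0) ∧
      ∀ᵐ t ∂volume.restrict (Ioc s (s + h)), ∀ x : ℝ → EuclideanSpace ℝ (Fin d),
        ∫ u in Icc (s - τ) (s + h), k (t, u) (x u) = rhs τ C x t := by
  let ι : (Fin d → Fin d → ℝ) →L[ℝ] EuclideanSpace ℝ (Fin d) →L[ℝ] EuclideanSpace ℝ (Fin d) :=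
    LinearMap.toContinuousLinearMap
      (Matrix.toEuclideanCLM (n := Fin d) (𝕜 := ℝ)).toAlgEquiv.toLinearMap
  have hC' : MemLp (fun p : ℝ × ℝ => (C p.1 p.2 : Fin d → Fin d → ℝ)) ∞
      (volume.restrict (Icc s (s + h) ×ˢ Icc (-τ) 0)) := hC
  obtain ⟨g, hg, hCg, M, hM0, hM⟩ := exists_bounded_representative (ι.comp_memLp' hC')
  -- The condition `s < p.1` makes the operator vanish on the initial segment, leaving `φ`
  -- unperturbed there.
  set D : Set (ℝ × ℝ) := {p | s < p.1 ∧ p.2 - p.1 ∈ Icc (-τ) 0}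
  have hDm : MeasurableSet D :=
    (measurableSet_lt measurable_const measurable_fst).inter
      ((measurable_snd.sub measurable_fst) measurableSet_Icc)
  refine ⟨D.indicator fun p => g (p.1, p.2 - p.1),
    (hg.comp_measurable (measurable_fst.prodMk (measurable_snd.sub measurable_fst))).indicator hDm,
    ⟨M, hM0, fun p => ?_⟩, fun t u htu => ?_, fun t ht u => ?_, ?_⟩
  · by_cases hp : p ∈ D
    · rw [indicator_of_mem hp]; exact hM _
    · rw [indicator_of_notMem hp, norm_zero]; exact hM0.le
  · exact indicator_of_notMem (fun hp => by have := hp.2.2; simp only at this; linarith) _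
  · exact indicator_of_notMem (fun hp => not_lt.2 ht hp.1) _
  · rw [Measure.volume_eq_prod, ← Measure.prod_restrict] at hCg
    have h1 := ae_restrict_of_ae_restrict_of_subset Ioc_subset_Icc_self
      (Measure.ae_ae_of_ae_prod hCg)
    filter_upwards [h1, ae_restrict_mem measurableSet_Ioc] with t ht hts x
    have h2 : rhs τ C x t = ∫ θ in Icc (-τ) 0, g (t, θ) (x (t + θ)) := by
      refine integral_congr_ae ?_
      filter_upwards [ht] with θ hθ
      rw [← hθ]
      rfl
    rw [h2, ← integral_indicator measurableSet_Icc, ← integral_indicator measurableSet_Icc,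
      
      ← integral_sub_right_eq_self (indicator (Icc (-τ) 0) fun θ => g (t, θ) (x (t + θ))) t]
    refine integral_congr_ae (Filter.Eventually.of_forall fun u => ?_)
    by_cases hu : u - t ∈ Icc (-τ) 0
    -- For `s < t ≤ s + h` the window `[t - τ, t]` lies in `K`, so integrating over `K` loses
    -- nothing.
    · have hK : u ∈ Icc (s - τ) (s + h) :=
        ⟨by linarith [hu.1, hts.1], by linarith [hu.2, hts.2]⟩
      simp only
      rw [indicator_of_mem hu, indicator_of_mem hK,
        indicator_of_mem (show (t, u) ∈ D from ⟨hts.1, hu⟩),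
        add_sub_cancel]
    · simp only
      rw [indicator_of_notMem hu, indicator_apply_eq_zero]
      intro _
      rw [indicator_of_notMem (fun hp : (t, u) ∈ D => hu hp.2), _root_.zero_apply]

/-- Allows passage from functions to `L²` classes: the right-hand side integrates over a window
inside `K`, so null sets do not affect it. -/
theorem IsSolution.congr (hh : 0 ≤ h) {φ : StateSpace d τ} {x y : ℝ → EuclideanSpace ℝ (Fin d)}
    (hx : IsSolution τ s (s + h) C φ x)
    (hxy : x =ᵐ[volume.restrict (Icc (s - τ) (s + h))] y) (hτ : 0 ≤ τ) :
    IsSolution τ s (s + h) C φ y where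
  memLp := hx.memLp.ae_eq hxy
  initial := by
    have h1 := ae_restrict_add_left (A := Icc (-τ) 0) measurableSet_Icc (c := s)
      (fun t ht => ⟨by linarith [ht.1], by linarith [ht.2]⟩) hxy
    filter_upwards [hx.initial, h1] with θ h2 h3
    rw [← h2]
    exact h3.symm
  equation := by
    have h1 := ae_restrict_of_ae_restrict_of_subset
      (show Ioc s (s + h) ⊆ Icc (s - τ) (s + h) from
        fun t ht => ⟨by linarith [ht.1], ht.2⟩) hxy
    filter_upwards [hx.equation, h1, ae_restrict_mem measurableSet_Ioc] with r h2 h3 hr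
    rw [← h3, h2]
    have h4 := ae_restrict_add_left (A := Icc (-τ) 0) measurableSet_Icc (c := r)
      (fun t ht => ⟨by linarith [ht.1, hr.1], by linarith [ht.2, hr.2]⟩) hxy
    refine integral_congr_ae ?_
    filter_upwards [h4] with θ hθ
    simp only [history]
    rw [hθ]

/-- The initial value problem is a fixed point equation in `L²([s - τ, s + h])`. -/
theorem isSolution_iff (hτ : 0 ≤ τ) (hh : 0 ≤ h)
    {X Y Z : Lp (EuclideanSpace ℝ (Fin d)) 2 (volume.restrict (Icc (s - τ) (s + h)))}
    {φ : StateSpace d τ}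
    (hY : Y =ᵐ[volume.restrict (Icc (s - τ) (s + h))] (Iic s).indicator (φ ∘ fun t => -s + t))
    (hZ₀ : ∀ᵐ t ∂volume.restrict (Icc (s - τ) (s + h)), t ≤ s → Z t = 0)
    (hZ : ∀ᵐ t ∂volume.restrict (Ioc s (s + h)), Z t = rhs τ C X t) :
    IsSolution τ s (s + h) C φ X ↔ X = Y + Z := by
  have hJK : Icc (s - τ) s ⊆ Icc (s - τ) (s + h) := Icc_subset_Icc_right (by linarith)
  have hIK : Ioc s (s + h) ⊆ Icc (s - τ) (s + h) := fun t ht => ⟨by linarith [ht.1], ht.2⟩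
  have hU : Icc (s - τ) (s + h) = Icc (s - τ) s ∪ Ioc s (s + h) :=
    (Icc_union_Ioc_eq_Icc (by linarith) (by linarith)).symm
  have hsum₀ : ∀ᵐ t ∂volume.restrict (Icc (s - τ) s), (Y + Z) t = φ (-s + t) := by
    filter_upwards [ae_restrict_of_ae_restrict_of_subset hJK hY,
      ae_restrict_of_ae_restrict_of_subset hJK hZ₀,
      ae_restrict_of_ae_restrict_of_subset hJK (Lp.coeFn_add Y Z),
      ae_restrict_mem measurableSet_Icc] with t h1 h2 h3 ht
    rw [h3, Pi.add_apply, h1, h2 ht.2, add_zero, indicator_of_mem (show t ∈ Iic s from ht.2)]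
    rfl
  have hsum : ∀ᵐ t ∂volume.restrict (Ioc s (s + h)), (Y + Z) t = rhs τ C X t := by
    filter_upwards [ae_restrict_of_ae_restrict_of_subset hIK hY, hZ,
      ae_restrict_of_ae_restrict_of_subset hIK (Lp.coeFn_add Y Z),
      ae_restrict_mem measurableSet_Ioc] with t h1 h2 h3 ht
    rw [h3, Pi.add_apply, h1, h2, indicator_of_notMem (fun h : t ∈ Iic s => not_lt.2 h ht.1),
      zero_add]
  constructor
  · intro hX
    refine Lp.ext ?_
    suffices ∀ᵐ t ∂volume.restrict (Icc (s - τ) s ∪ Ioc s (s + h)), X t = (Y + Z) t by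
      rwa [← hU] at this
    refine (ae_restrict_union_iff _ _ _).2 ⟨?_, ?_⟩
    · have h1 := ae_restrict_add_left (A := Icc (s - τ) s) measurableSet_Icc (c := -s)
        (fun t ht => ⟨by linarith [ht.1], by linarith [ht.2]⟩) hX.initial
      filter_upwards [h1, hsum₀] with t h2 h3
      rw [h3, ← h2, history, add_neg_cancel_left]
    · filter_upwards [hX.equation, hsum] with t h1 h2
      rw [h1, h2]
  · intro hX
    rw [← hX] at hsum hsum₀
    refine ⟨Lp.memLp X, ?_, hsum⟩
    have h1 := ae_restrict_add_left (A := Icc (-τ) 0) measurableSet_Icc (c := s)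
      (fun t ht => ⟨by linarith [ht.1], by linarith [ht.2]⟩) hsum₀
    filter_upwards [h1] with θ hθ
    rw [history, hθ, neg_add_cancel_left]

end RenewalEq

/-! ### Inversion of `1 - V` and compactness of the evolution operator -/

open RenewalEq in
theorem mainTheorem2 (d : ℕ) (hd : 0 < d) (τ : ℝ) (hτ : 0 < τ) (s h : ℝ) (hh : τ ≤ h)
    (C : ℝ → ℝ → Matrix (Fin d) (Fin d) ℝ) (hC : RenewalEq.IsLInfKernel τ s (s + h) C) :
    (∀ φ : RenewalEq.StateSpace d τ, ∃ x : ℝ → EuclideanSpace ℝ (Fin d),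
      RenewalEq.IsSolution τ s (s + h) C φ x ∧
      (∀ y : ℝ → EuclideanSpace ℝ (Fin d), RenewalEq.IsSolution τ s (s + h) C φ y →
        y =ᵐ[volume.restrict (Icc (s - τ) (s + h))] x) ∧
      RenewalEq.evolutionOperator τ C (s + h) s φ =ᵐ[volume.restrict (Icc (-τ) 0)]
        RenewalEq.history x (s + h)) ∧
    ∃ T : RenewalEq.StateSpace d τ →L[ℝ] RenewalEq.StateSpace d τ,
      (∀ φ : RenewalEq.StateSpace d τ, T φ = RenewalEq.evolutionOperator τ C (s + h) s φ) ∧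
      IsCompactOperator T := by
  have hh0 : 0 ≤ h := hτ.le.trans hh
  obtain ⟨k, hk, ⟨M, hM0, hM⟩, hvol, hzero, hrhs⟩ := exists_volterra_kernel hC
  set K := Icc (s - τ) (s + h)
  have hIK : Ioc s (s + h) ⊆ K := fun t ht => ⟨by linarith [ht.1], ht.2⟩
  obtain ⟨V, hV⟩ := exists_clm_kernel (μ := volume.restrict K) hk hM0.le hM
  have hVc : IsCompactOperator V := isCompactOperator_of_kernel hk hM0.le hM hV
  obtain ⟨E, hE⟩ := exists_clm_indicator_comp (F := EuclideanSpace ℝ (Fin d))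
    (μ := volume.restrict K) (ν := volume.restrict (Icc (-τ) 0))
    (measurable_const_add (-s)) (measurableSet_Iic (a := s)) (by
      rw [Measure.restrict_restrict measurableSet_Iic]
      exact map_add_left_restrict_le measurableSet_Icc fun t ht =>
        ⟨by linarith [ht.2.1], by linarith [show t ≤ s from ht.1]⟩)
  have hshift : ∀ θ ∈ Icc (-τ) 0, s + h + θ ∈ K := fun θ hθ =>
    ⟨by linarith [hθ.1], by linarith [hθ.2]⟩
  obtain ⟨R, hR⟩ := exists_clm_indicator_comp (F := EuclideanSpace ℝ (Fin d))
    (ν := volume.restrict K) (μ := volume.restrict (Icc (-τ) 0))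
    (measurable_const_add (s + h)) MeasurableSet.univ (by
      rw [Measure.restrict_univ]
      exact map_add_left_restrict_le measurableSet_Icc hshift)
  simp only [indicator_univ] at hR
  -- Fredholm alternative: otherwise 1 is an eigenvalue, and an eigenvector is a nonzero Volterra
  -- fixed point.
  have hres : (1 : ℝ) ∈ resolventSet ℝ V := by
    refine (hVc.hasEigenvalue_or_mem_resolventSet one_ne_zero).resolve_left fun hev => ?_
    obtain ⟨v, hv⟩ := hev.exists_hasEigenvector
    have hVv : V v = v := by simpa using hv.apply_eq_smul
    refine hv.2 (Lp.eq_zero_iff_ae_eq_zero.2 (volterra_eq_zero hM0 hM hvol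
      ((Lp.memLp v).integrable (by norm_num)) ?_))
    have := hV v
    rwa [hVv] at this
  obtain ⟨S, hS₁, hS₂⟩ : ∃ S, (1 - V) * S = 1 ∧ S * (1 - V) = 1 := by
    obtain ⟨U, hU⟩ := spectrum.mem_resolventSet_iff.1 hres
    rw [map_one] at hU
    exact ⟨↑U⁻¹, by rw [← hU, U.mul_inv], by rw [← hU, U.inv_mul]⟩
  have hfix : ∀ X W, X = W + V X ↔ X = S W := fun X W => by
    constructor
    · intro hX
      have h1 : (1 - V) X = W := by
        rw [_root_.sub_apply, one_apply_eq_self, sub_eq_iff_eq_add]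
        exact hX
      rw [← h1, ← mul_apply_eq_comp, hS₂, one_apply_eq_self]
    · intro hX
      have h1 : (1 - V) X = W := by
        rw [hX, ← mul_apply_eq_comp, hS₁, one_apply_eq_self]
      rw [← sub_eq_iff_eq_add]
      exact h1
  have hV₀ : ∀ X, ∀ᵐ t ∂volume.restrict K, t ≤ s → V X t = 0 := fun X => by
    filter_upwards [hV X] with t ht hts
    rw [ht]
    simp [hzero t hts]
  have hV₁ : ∀ X, ∀ᵐ t ∂volume.restrict (Ioc s (s + h)), V X t = rhs τ C X t := fun X => by
    filter_upwards [ae_restrict_of_ae_restrict_of_subset hIK (hV X), hrhs] with t h1 h2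
    rw [h1, h2]
  have hsol : ∀ (φ : StateSpace d τ)
      (X : Lp (EuclideanSpace ℝ (Fin d)) 2 (volume.restrict K)),
      IsSolution τ s (s + h) C φ X ↔ X = S (E φ) := fun φ X =>
    (isSolution_iff hτ.le hh0 (hE φ) (hV₀ X) (hV₁ X)).trans (hfix X (E φ))
  have huniq : ∀ (φ : StateSpace d τ) y, IsSolution τ s (s + h) C φ y →
      y =ᵐ[volume.restrict K] S (E φ) := fun φ y hy => by
    have h1 := hy.memLp.coeFn_toLp
    rw [← (hsol φ _).1 (hy.congr hh0 h1.symm hτ.le)]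
    exact h1.symm
  have hevol : ∀ φ : StateSpace d τ, evolutionOperator τ C (s + h) s φ
      =ᵐ[volume.restrict (Icc (-τ) 0)] history (S (E φ)) (s + h) := fun φ => by
    have hex : ∃ ψ, IsEvolved τ s (s + h) C φ ψ := ⟨R (S (E φ)), S (E φ), (hsol φ _).2 rfl, hR _⟩
    rw [evolutionOperator, dif_pos hex]
    -- The chosen state may come from another solution `y`; uniqueness identifies it with `S (E φ)`.
    obtain ⟨y, hy, hψ⟩ := hex.choose_spec
    filter_upwards [hψ, ae_restrict_add_left measurableSet_Icc hshift (huniq φ y hy)]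
      with θ h1 h2
    rw [h1]
    exact h2
  refine ⟨fun φ => ⟨S (E φ), (hsol φ _).2 rfl, huniq φ, hevol φ⟩,
    R.comp (V.comp (S.comp E)), fun φ => ?_, ?_⟩
  · refine Lp.ext ?_
    have hEφ : ∀ᵐ t ∂volume.restrict (Ioc s (s + h)), V (S (E φ)) t = S (E φ) t := by
      filter_upwards [hV₁ (S (E φ)), ((hsol φ _).2 rfl).equation] with t h1 h2
      rw [h1, h2]
    -- Here `τ ≤ h` enters. The half-open window covers `h = τ`, when the left endpoint lands on
    -- `s`, outside the equation's domain.
    have hIcc := ae_restrict_add_left (A := Ioc (-τ) 0) measurableSet_Ioc (c := s + h)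
      (fun t ht => ⟨by linarith [ht.1], by linarith [ht.2]⟩) hEφ
    rw [Measure.restrict_congr_set Ioc_ae_eq_Icc] at hIcc
    filter_upwards [hR (V (S (E φ))), hevol φ, hIcc] with θ h1 h2 h3
    rw [h2]
    exact h1.trans h3
  · exact (hVc.comp_clm (S.comp E)).clm_comp R
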